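/- For $i\in\mathbb N=\{0,1,2,\dots\}$ let $M_i=\{j\cdot 2^{-i} : j\in\{0,1,\dots,2^i\}\}$, and let $\mathsf M$ be the subspace of the Banach space $\ell_1$ (absolutely summable real sequences, with the topology of the $1$-norm) consisting of all $x\in\ell_1$ with $x(i)\in M_i$ for all $i$. Let $\mathbb F$ be the countable metric fan, i.e. the set $\mathbb N^2\cup\{(\infty,\infty)\}$ with the metric in which $(a,b)$ has distance $2^{-a}$ to $(\infty,\infty)$ and distinct points $(a,b),(a',b')\in\mathbb N^2$ have distance $\max\{2^{-a},2^{-a'}\}$. Let $\mathsf 2=\{0,1\}$ and $\mathbb N$ be discrete, let $\mathbb N^{\mathbb N}$ be the Baire space, and let $\prod_{i} M_i$ carry the product topology of the discrete spaces $M_i$. The sequentialisation of a topological space has the same points and, as open sets, the sequentially open sets. A QCB-space is a topological quotient of a countably based space. The QCB-exponential $\mathsf Y^{\mathsf X}$ is the set of continuous functions $\mathsf X\to\mathsf Y$ with the sequentialisation of the compact-open topology, and the QCB-product is the sequentialisation of the topological product. Put $\mathsf P=\prod_i M_i\times \mathsf 2^{\mathbb N\times\mathbb F}$ (QCB-product).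 A retract in QCB is a QCB-space $\mathsf X$ together with a QCB-space $\mathsf Y$ and continuous maps $e:\mathsf X\to\mathsf Y$, $r:\mathsf Y\to\mathsf X$ with $r\circ e=\mathrm{id}_{\mathsf X}$. For $x\in\prod_i M_i$ and $k,a,b\in\mathbb N$ let $f(x,k,a,b)=0$ if $\sum_{i=a}^{a+b}x(i)\le 2^{-k}$, and $f(x,k,a,b)=1$ otherwise. For $y\in\mathsf M$ let $g(y)(k,a,b)=f(y,k,a,b)$ and $g(y)(k,\infty,\infty)=0$. For $m\in\mathbb N$ let $$C_m=\{(x,h)\in\mathsf P : h(k,\infty,\infty)=0 \text{ and } h(k,a,b)=f(x,k,a,b)\text{ for all } k,a,b\le m\},$$ and for $(x,h)\in\mathsf P$ let $r_{\mathsf M}(x,h)(m)=x(m)$ if $(x,h)\in C_m$, and $r_{\mathsf M}(x,h)(m)=0$ otherwise. Then the following hold. 1. $\mathsf M$ is closed in $\ell_1$ and is a Polish space. 2. $\mathsf M$ is a retract of $\mathsf P$ in QCB. More precisely, $\mathsf M$ and $\mathsf P$ are QCB-spaces, every $C_m$ is clopen in $\mathsf P$, and $e_{\mathsf M}(x)=(x,g(x))$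 and $r_{\mathsf M}$ are well-defined continuous maps $e_{\mathsf M}:\mathsf M\to\mathsf P$ and $r_{\mathsf M}:\mathsf P\to\mathsf M$ with $r_{\mathsf M}\circ e_{\mathsf M}=\mathrm{id}_{\mathsf M}$. 3. $\mathsf M$ is a retract in QCB of the QCB-exponential $\mathsf 2^{\mathbb N\times\mathbb F}$ and of the QCB-exponential $\mathbb N^{\mathbb N^{\mathbb N}}$. -/

import Mathlib

open Filter Topology

noncomputable section

namespace WMRetract

universe u v

/-! ### Sequential spaces and the category QCB -/

/-- The sequentialisation (sequential coreflection) of a topological space `X`: the same points,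
topologised by the sequentially open sets of `X`. -/
structure Seqn (X : Type u) where
  /-- view a point of `X` as a point of the sequentialisation -/
  of ::
  /-- the underlying point of `X` -/
  val : X

/-- A set is open iff every sequence converging in `X` to one of its points is eventually
inside. -/
instance Seqn.instTopologicalSpace (X : Type u) [TopologicalSpace X] :
    TopologicalSpace (Seqn X) where
  IsOpen U := ∀ (x : ℕ → X) (p : X), Tendsto x atTop (𝓝 p) → Seqn.of p ∈ U →
    ∀ᶠ n in atTop, Seqn.of (x n) ∈ U
  isOpen_univ := fun _ _ _ _ => Eventually.of_forall fun _ => Set.mem_univ _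
  isOpen_inter := fun _ _ hU hV x p hx hp => (hU x p hx hp.1).and (hV x p hx hp.2)
  isOpen_sUnion := fun _ hS x p hx ⟨U, hU, hpU⟩ =>
    (hS U hU x p hx hpU).mono fun _ hn => ⟨U, hU, hn⟩

/-- The QCB-product of two spaces: the sequentialisation of the topological product. -/
abbrev QProd (X : Type u) (Y : Type v) : Type (max u v) := Seqn (X × Y)

/-- The QCB-exponential `Y ^ X`: the set of continuous functions from `X` to `Y`, with the
sequentialisation of the compact-open topology. -/
abbrev QExp (X : Type u) (Y : Type v) [TopologicalSpace X] [TopologicalSpace Y] :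
    Type (max u v) := Seqn C(X, Y)

/-- A QCB-space is a topological quotient of a countably based space. -/
def IsQCB (X : Type u) [TopologicalSpace X] : Prop :=
  ∃ (Z : Type u) (_ : TopologicalSpace Z) (_ : SecondCountableTopology Z) (q : Z → X),
    IsQuotientMap q

/-- `X` is a retract of `Y` in the category QCB. -/
def IsQCBRetract (X : Type u) (Y : Type v) [TopologicalSpace X] [TopologicalSpace Y] : Prop :=
  IsQCB X ∧ IsQCB Y ∧ ∃ (e : C(X, Y)) (r : C(Y, X)), ∀ x, r (e x) = x

/-! ### The space `M` -/

/-- The Banach space `ℓ₁` of absolutely summable real sequences. -/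
abbrev Ell1 : Type := lp (fun _ : ℕ => ℝ) 1

/-- The set `M_i = {j * 2^{-i} | j = 0, …, 2^i}`. -/
def dyadicSet (i : ℕ) : Set ℝ := {t | ∃ j : ℕ, j ≤ 2 ^ i ∧ t = (j : ℝ) / 2 ^ i}

/-- The set of sequences in `ℓ₁` whose `i`-th entry lies in `M_i` for all `i`. -/
def setM : Set Ell1 := {x | ∀ i, x i ∈ dyadicSet i}

/-- The space `M`, with the subspace topology of `ℓ₁`. -/
abbrev SpaceM : Type := setM

/-- The finite space `M_i`. -/
def FinM (i : ℕ) : Type := {t : ℝ // t ∈ dyadicSet i}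

/-- `M_i` is discrete. -/
instance FinM.instTopologicalSpace (i : ℕ) : TopologicalSpace (FinM i) := ⊥

/-- The product space `∏ M_i`, with the product topology. -/
abbrev ProdM : Type := ∀ i, FinM i

/-- The inclusion of the underlying set of `M` into that of `∏ M_i`. -/
def SpaceM.toProd (x : SpaceM) : ProdM := fun i => ⟨(x : Ell1) i, x.2 i⟩

/-! ### The countable metric fan -/

/-- The underlying set `ℕ² ∪ {(∞, ∞)}` of the fan. -/
inductive Fan : Type
  | pt (a b : ℕ) : Fan
  | infty : Fan

/-- The distance of a point of the fan to `(∞, ∞)`. -/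
def Fan.radius : Fan → ℝ
  | .pt a _ => (2⁻¹ : ℝ) ^ a
  | .infty => 0

theorem Fan.radius_nonneg (p : Fan) : 0 ≤ p.radius := by
  cases p <;> simp [Fan.radius]

theorem Fan.eq_infty_of_radius {p : Fan} (h : p.radius ≤ 0) : p = .infty := by
  cases p with
  | pt a b =>
    have : (0 : ℝ) < (2⁻¹ : ℝ) ^ a := by positivity
    exact absurd h (not_le.mpr this)
  | infty => rfl

open Classical in
/-- The metric of the fan: distinct points `(a, b)`, `(a', b')` have distance
`max (2^{-a}) (2^{-a'})`, where `2^{-∞} = 0`. -/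
instance Fan.instMetricSpace : MetricSpace Fan where
  dist p q := if p = q then 0 else max p.radius q.radius
  dist_self p := by simp
  dist_comm p q := by simp only [eq_comm (a := p), max_comm p.radius]
  dist_triangle p q s := by
    have hp := p.radius_nonneg
    have hq := q.radius_nonneg
    have hs := s.radius_nonneg
    by_cases h1 : p = q
    · subst h1; simp
    by_cases h2 : q = s
    · subst h2; simp
    by_cases h3 : p = s
    · simp only [h2, h3, if_true, if_false]; positivity
    simp only [h1, h2, h3, if_false]
    apply max_le
    · linarith [le_max_left p.radius q.radius, le_max_left q.radius s.radius]
    · linarith [le_max_right p.radius q.radius, le_max_right q.radius s.radius]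
  eq_of_dist_eq_zero := by
    intro p q h
    by_contra hne
    simp only [hne, if_false] at h
    have hp : p.radius ≤ 0 := h ▸ le_max_left _ _
    have hq : q.radius ≤ 0 := h ▸ le_max_right _ _
    exact hne ((Fan.eq_infty_of_radius hp).trans (Fan.eq_infty_of_radius hq).symm)

/-! ### The section and the retraction; the two-point space is `Bool`, with `0 = false` -/

/-- `2 ^ (ℕ × F)`, the QCB-exponential. -/
abbrev TwoPow : Type := QExp (ℕ × Fan) Bool

/-- `ℕ ^ (ℕ ^ ℕ)`, the QCB-exponential with the Baire space as exponent. -/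
abbrev NNN : Type := QExp (ℕ → ℕ) ℕ

open Classical in
/-- `f x k a b` is `0` if `∑_{i=a}^{a+b} x i ≤ 2^{-k}`, and `1` otherwise. -/
def f (x : ProdM) (k a b : ℕ) : Bool :=
  if ∑ i ∈ Finset.Icc a (a + b), (x i).val ≤ (2⁻¹ : ℝ) ^ k then false else true

/-- `g y (k, (a, b)) = f y k a b` and `g y (k, (∞, ∞)) = 0`. -/
def g (y : SpaceM) : ℕ × Fan → Bool
  | (k, .pt a b) => f y.toProd k a b
  | (_, .infty) => false

/-- The set `C_m` of all `(x, h)` with `h (k, (∞, ∞)) = 0` and `h (k, (a, b)) = f x k a b` for all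
`k, a, b ≤ m`. -/
def C (m : ℕ) : Set (QProd ProdM TwoPow) :=
  {p | ∀ k ≤ m, ∀ a ≤ m, ∀ b ≤ m,
    p.val.2.val (k, .infty) = false ∧ p.val.2.val (k, .pt a b) = f p.val.1 k a b}

open Classical in
/-- The sequence `r_M (x, h)`: its `m`-th entry is `x m` if `(x, h) ∈ C_m`, and `0` otherwise. -/
def rSeq (p : QProd ProdM TwoPow) (m : ℕ) : ℝ :=
  if p ∈ C m then (p.val.1 m).val else 0

/-- `e` is the map `x ↦ (x, g x)`. -/
def IsSectionMap (e : SpaceM → QProd ProdM TwoPow) : Prop :=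
  ∀ x, (e x).val.1 = x.toProd ∧ ⇑(e x).val.2.val = g x

/-- `r` is the map `(x, h) ↦ r_M (x, h)`. -/
def IsRetractionMap (r : QProd ProdM TwoPow → SpaceM) : Prop :=
  ∀ p m, (r p : Ell1) m = rSeq p m

end WMRetract

end

/-!
The sequentialisation of a space has the same convergent sequences as the space, so continuity out
of the spaces at hand is continuity along sequences, and over a first countable domain a sequence
converges in the compact-open topology iff it converges continuously
(`tendsto_compactOpen_iff_tendsto_prod`).

**QCB.** A sequentialisation `Seqn X` is a QCB-space as soon as `X` has a countable sequential
network (`HasSeqNetwork.isQCB`): it is a quotient of the countably based space of all points paired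
with a name, i.e. a subfamily of the network that shrinks to the point. Second countable spaces and
function spaces between them have such networks, and products and sequentialisations inherit them.

**The retraction.** In `M` a sequence converges if it converges coordinatewise and its tails are
uniformly small (`SpaceM.tendsto_of_sum_le`), and conversely the tails are uniformly small near
each point of `M`, which makes `g` jointly continuous. For `(x, h)` the continuity of `h` at
`(k, (∞, ∞))` yields an `A` such that `h (k, (a, b)) = 0` for all `a ≥ A` and all `b`, also for the
terms of a sequence converging to `(x, h)`. As long as `(x, h)` stays in the decreasing clopen sets
`C m`, this bounds the partial sums of `x` from `A` on by `2^{-k}`; afterwards `r_M (x, h)` vanishes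
(`sum_rSeq_le`, `exists_eventually_sum_rSeq_le`). So `r_M (x, h)` is summable, and `r_M` is
continuous.

**The exponentials.** The points `(0, (0, c))` of `ℕ × F` are isolated and can store the bits of
`x`, and the layers `k + 1` can store `h`, so `∏ M_i × 2 ^ (ℕ × F)` is a retract of `2 ^ (ℕ × F)`.
Sending a sequence to the point given by its first nonzero term makes the fan a retract of the
Baire space; hence so is `ℕ × F`, and `2 ^ (ℕ × F)` is a retract of `ℕ ^ (ℕ ^ ℕ)`.
-/

namespace WMRetract

universe u v

/-! ### The sequentialisation -/

section Sequentialisation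

variable {X : Type u} {Y : Type v} [TopologicalSpace X] [TopologicalSpace Y]

theorem Seqn.continuous_val : Continuous (Seqn.val : Seqn X → X) :=
  ⟨fun _ hU _ _ hx hp => hx.eventually (hU.mem_nhds hp)⟩

/-- A space and its sequentialisation have the same convergent sequences. -/
theorem Seqn.tendsto_iff {x : ℕ → Seqn X} {p : Seqn X} :
    Tendsto x atTop (𝓝 p) ↔ Tendsto (fun n => (x n).val) atTop (𝓝 p.val) := by
  refine ⟨fun h => (Seqn.continuous_val.tendsto p).comp h, fun h => ?_⟩
  rw [tendsto_nhds]
  exact fun U hU hp => hU _ _ h hp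

instance Seqn.instSequentialSpace : SequentialSpace (Seqn X) where
  isClosed_of_seq s hs := by
    rw [← isOpen_compl_iff]
    intro x p hx hp
    by_contra hcon
    obtain ⟨φ, hφ, hφs⟩ := extraction_of_frequently_atTop (not_eventually.mp hcon)
    refine hp (hs (x := fun n => Seqn.of (x (φ n))) (fun n => not_not.mp (hφs n)) ?_)
    exact Seqn.tendsto_iff.2 (hx.comp hφ.tendsto_atTop)

/-- The sequentialisation is a coreflection: on a sequential space, continuity into `Seqn X` is
continuity into `X`. -/
theorem Seqn.continuous_of_val [SequentialSpace Y] {φ : Y → Seqn X}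
    (h : Continuous fun y => (φ y).val) : Continuous φ :=
  SeqContinuous.continuous fun _ _ hx => Seqn.tendsto_iff.2 (h.seqContinuous hx)

/-- The functorial action of the sequentialisation on continuous maps. -/
def Seqn.map (φ : C(X, Y)) : C(Seqn X, Seqn Y) where
  toFun x := .of (φ x.val)
  continuous_toFun := Seqn.continuous_of_val (φ.continuous.comp Seqn.continuous_val)

end Sequentialisation

/-! ### Sequential networks -/

theorem tendsto_generate_iff {ι α : Type*} {l : Filter ι} {y : ι → α} {𝒜 : Set (Set α)} :
    Tendsto y l (generate 𝒜) ↔ ∀ B ∈ 𝒜, ∀ᶠ n in l, y n ∈ B :=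
  le_generate_iff

section Network

variable {X : Type u} {Y : Type v} [TopologicalSpace X] [TopologicalSpace Y]

/-- A family `𝒜` of sets names the point `p` if all its members contain `p` and every sequence
that is eventually in each member converges to `p`. -/
def Names (𝒜 : Set (Set X)) (p : X) : Prop :=
  (∀ B ∈ 𝒜, p ∈ B) ∧ ∀ y : ℕ → X, Tendsto y atTop (generate 𝒜) → Tendsto y atTop (𝓝 p)

/-- `X` has a countable family of sets such that, for each convergent sequence, those members that
contain the limit and almost all terms name the limit. The condition depends on the convergent
sequences of `X` only. -/
def HasSeqNetwork (X : Type u) [TopologicalSpace X] : Prop :=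
  ∃ 𝓑 : Set (Set X), 𝓑.Countable ∧ ∀ (x : ℕ → X) (p : X), Tendsto x atTop (𝓝 p) →
    Names {B ∈ 𝓑 | p ∈ B ∧ ∀ᶠ n in atTop, x n ∈ B} p

/-- A countable family that names a point shrinks into every sequentially open neighbourhood of
that point. -/
theorem Names.exists_finite {𝒜 : Set (Set X)} {p : X} (h : Names 𝒜 p) (hc : 𝒜.Countable)
    {U : Set (Seqn X)} (hU : IsOpen U) (hp : Seqn.of p ∈ U) :
    ∃ t ⊆ 𝒜, t.Finite ∧ ∀ x, (∀ B ∈ t, x ∈ B) → Seqn.of x ∈ U := by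
  have : IsCountablyGenerated (generate 𝒜) := ⟨𝒜, hc, rfl⟩
  have key : Tendsto (Seqn.of : X → Seqn X) (generate 𝒜) (𝓟 U) :=
    tendsto_of_seq_tendsto fun y hy => tendsto_principal.2 (hU y p (h.2 y hy) hp)
  obtain ⟨t, ht, hfin, hsub⟩ := mem_generate_iff.1 (tendsto_principal.1 key)
  exact ⟨t, ht, hfin, fun x hx => hsub (Set.mem_sInter.2 hx)⟩

/-- The sequentialisation is a quotient of the space of all pairs of a point and a family that
names it, where a subbasic open set prescribes one member of the family. -/
theorem HasSeqNetwork.isQCB (h : HasSeqNetwork X) : IsQCB (Seqn X) := by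
  obtain ⟨𝓑, hc, hB⟩ := h
  have : Countable 𝓑 := hc.to_subtype
  let Z := {z : (𝓑 → Prop) × X // Names (Subtype.val '' {b | z.1 b}) z.2}
  let π : Z → 𝓑 → Prop := fun z => z.1.1
  let _ : TopologicalSpace Z := TopologicalSpace.induced π inferInstance
  have hπ : IsInducing π := ⟨rfl⟩
  -- the name of `p` determined by a sequence that converges to `p`
  have name (x : ℕ → X) (p : X) (hx : Tendsto x atTop (𝓝 p)) :
      Names (Subtype.val '' {b : 𝓑 | p ∈ b.1 ∧ ∀ᶠ n in atTop, x n ∈ b.1}) p := by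
    convert hB x p hx using 1
    ext B
    exact ⟨fun ⟨b, hb, h⟩ => h ▸ ⟨b.2, hb⟩, fun ⟨h, hb⟩ => ⟨⟨B, h⟩, hb, rfl⟩⟩
  refine ⟨Z, inferInstance, hπ.secondCountableTopology, fun z => Seqn.of z.1.2, ?_⟩
  rw [isQuotientMap_iff]
  refine ⟨.of_isOpen_preimage_iff_isOpen fun V => ⟨fun hV x p hx hp => ?_, fun hV => ?_⟩,
    fun p => ⟨⟨(_, p.val), name _ p.val (tendsto_const_nhds (f := atTop))⟩, rfl⟩⟩
  · -- the full names of the terms converge to the name of the limit determined by the sequence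
    let z : Z := ⟨(_, p), name x p hx⟩
    let w (n : ℕ) : Z := ⟨(_, x n), name (fun _ => x n) (x n) tendsto_const_nhds⟩
    have hw : Tendsto w atTop (𝓝 z) := by
      rw [hπ.tendsto_nhds_iff, tendsto_pi_nhds]
      intro b
      rw [tendsto_nhds_Prop]
      rintro ⟨-, hb⟩
      filter_upwards [hb] with n hn
      exact ⟨hn, Eventually.of_forall fun _ => hn⟩
    exact hw.eventually (hV.mem_nhds (show z ∈ _ from hp))
  · rw [isOpen_iff_mem_nhds]
    intro z hz
    obtain ⟨t, ht, hfin, hsub⟩ :=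
      z.2.exists_finite ((Set.to_countable _).image _) hV hz
    have hmem : ∀ᶠ w in 𝓝 z, ∀ B ∈ t, B ∈ Subtype.val '' {b : 𝓑 | w.1.1 b} := by
      rw [eventually_all_finite hfin]
      intro B hBt
      obtain ⟨b, hb, rfl⟩ := ht hBt
      have hcont : Continuous fun w : Z => w.1.1 b := (continuous_apply b).comp hπ.continuous
      filter_upwards [(continuous_Prop.1 hcont).mem_nhds hb] with w hw
      exact ⟨b, hw, rfl⟩
    filter_upwards [hmem] with w hw
    exact hsub _ fun B hBt => w.2.1 B (hw B hBt)

theorem hasSeqNetwork_of_secondCountable [SecondCountableTopology X] : HasSeqNetwork X := by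
  refine ⟨TopologicalSpace.countableBasis X, TopologicalSpace.countable_countableBasis X,
    fun x p hx => ⟨fun B hB => hB.2.1, fun y hy => ?_⟩⟩
  have hb := TopologicalSpace.isBasis_countableBasis X
  rw [hb.nhds_hasBasis.tendsto_right_iff]
  rintro B ⟨hB, hpB⟩
  exact hy (GenerateSets.basic ⟨hB, hpB, hx.eventually ((hb.isOpen hB).mem_nhds hpB)⟩)

theorem HasSeqNetwork.seqn (h : HasSeqNetwork X) : HasSeqNetwork (Seqn X) := by
  obtain ⟨𝓑, hc, hB⟩ := h
  refine ⟨(Seqn.val ⁻¹' ·) '' 𝓑, hc.image _, fun x p hx => ⟨fun B hB => hB.2.1, fun y hy => ?_⟩⟩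
  rw [Seqn.tendsto_iff] at hx ⊢
  refine (hB _ _ hx).2 _ (tendsto_generate_iff.2 fun B hBm => ?_)
  exact tendsto_generate_iff.1 hy _ ⟨⟨B, hBm.1, rfl⟩, hBm.2⟩

theorem HasSeqNetwork.prod (hX : HasSeqNetwork X) (hY : HasSeqNetwork Y) :
    HasSeqNetwork (X × Y) := by
  obtain ⟨𝓑, hc, hB⟩ := hX
  obtain ⟨𝓓, hd, hD⟩ := hY
  refine ⟨(Prod.fst ⁻¹' ·) '' 𝓑 ∪ (Prod.snd ⁻¹' ·) '' 𝓓, (hc.image _).union (hd.image _),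
    fun x p hx => ⟨fun B hB => hB.2.1, fun y hy => ?_⟩⟩
  rw [Prod.tendsto_iff] at hx ⊢
  constructor
  · refine (hB _ _ hx.1).2 _ (tendsto_generate_iff.2 fun B hBm => ?_)
    exact tendsto_generate_iff.1 hy _ ⟨Or.inl ⟨B, hBm.1, rfl⟩, hBm.2⟩
  · refine (hD _ _ hx.2).2 _ (tendsto_generate_iff.2 fun B hBm => ?_)
    exact tendsto_generate_iff.1 hy _ ⟨Or.inr ⟨B, hBm.1, rfl⟩, hBm.2⟩

end Network

/-! ### Sequences in the compact-open topology -/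

section CompactOpen

variable {X : Type u} {Y : Type v} [TopologicalSpace X] [TopologicalSpace Y]

theorem tendsto_compactOpen_of_tendsto_prod {ι : Type*} {l : Filter ι} {h : ι → C(X, Y)}
    {h₀ : C(X, Y)}
    (H : ∀ x, Tendsto (fun q : ι × X => h q.1 q.2) (l ×ˢ 𝓝 x) (𝓝 (h₀ x))) :
    Tendsto h l (𝓝 h₀) := by
  rw [ContinuousMap.tendsto_nhds_compactOpen]
  intro K hK U hU hKU
  have hmem : {q : ι × X | h q.1 q.2 ∈ U} ∈ l ×ˢ 𝓝ˢ K :=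
    hK.mem_prod_nhdsSet_of_forall fun x hx => (H x).eventually (hU.mem_nhds (hKU hx))
  obtain ⟨s, hs, t, ht, hst⟩ := mem_prod_iff.1 hmem
  filter_upwards [hs] with a ha x hx
  exact hst (Set.mk_mem_prod ha (subset_of_mem_nhdsSet ht hx))

/-- Over a first countable domain, a sequence converges in the compact-open topology iff it
converges continuously. -/
theorem tendsto_compactOpen_iff_tendsto_prod [FirstCountableTopology X] {h : ℕ → C(X, Y)}
    {h₀ : C(X, Y)} : Tendsto h atTop (𝓝 h₀) ↔
      ∀ x, Tendsto (fun q : ℕ × X => h q.1 q.2) (atTop ×ˢ 𝓝 x) (𝓝 (h₀ x)) := by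
  refine ⟨fun H x => tendsto_of_seq_tendsto fun q hq => ?_, tendsto_compactOpen_of_tendsto_prod⟩
  rw [tendsto_prod_iff'] at hq
  rw [tendsto_nhds]
  intro V hV hxV
  obtain ⟨N, hN⟩ := eventually_atTop.1
    (((h₀.continuous.tendsto x).comp hq.2).eventually (hV.mem_nhds hxV))
  -- the limit and the terms that `h₀` maps into `V` form a compact set
  have hK : IsCompact (insert x (Set.range fun n => (q (n + N)).2)) :=
    Tendsto.isCompact_insert_range (hq.2.comp (tendsto_add_atTop_nat N))
  have hmaps : Set.MapsTo h₀ (insert x (Set.range fun n => (q (n + N)).2)) V := by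
    rintro _ (rfl | ⟨n, rfl⟩)
    · exact hxV
    · exact hN _ (Nat.le_add_left _ _)
  have hev := hq.1.eventually (ContinuousMap.tendsto_nhds_compactOpen.1 H _ hK V hV hmaps)
  filter_upwards [hev, eventually_ge_atTop N] with n hn hNn
  exact hn (Or.inr ⟨n - N, by simp [Nat.sub_add_cancel hNn]⟩)

/-- The sets of all maps that send one basic open set into another form a sequential network of
the function space. -/
theorem hasSeqNetwork_continuousMap [SecondCountableTopology X] [SecondCountableTopology Y] :
    HasSeqNetwork C(X, Y) := by
  have hbX := TopologicalSpace.isBasis_countableBasis X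
  have hbY := TopologicalSpace.isBasis_countableBasis Y
  refine ⟨Set.image2 (fun U V => {h : C(X, Y) | Set.MapsTo h U V})
      (TopologicalSpace.countableBasis X) (TopologicalSpace.countableBasis Y),
    (TopologicalSpace.countable_countableBasis X).image2
      (TopologicalSpace.countable_countableBasis Y) _,
    fun h h₀ hh => ⟨fun B hB => hB.2.1, fun k hk => tendsto_compactOpen_of_tendsto_prod fun x => ?_⟩⟩
  rw [tendsto_compactOpen_iff_tendsto_prod] at hh
  rw [hbY.nhds_hasBasis.tendsto_right_iff]
  rintro V ⟨hV, hxV⟩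
  have hVn := (hbY.isOpen hV).mem_nhds hxV
  obtain ⟨s, hs, t, ht, hst⟩ := mem_prod_iff.1 ((hh x).eventually hVn)
  obtain ⟨U, hU, hxU, hUt⟩ :=
    hbX.mem_nhds_iff.1 (inter_mem ht (h₀.continuous.continuousAt.eventually hVn))
  have hkUV : ∀ᶠ n in atTop, Set.MapsTo (k n) U V := by
    refine tendsto_generate_iff.1 hk _ ⟨⟨U, hU, V, hV, rfl⟩, fun u hu => (hUt hu).2, ?_⟩
    filter_upwards [hs] with n hn u hu
    exact hst (Set.mk_mem_prod hn (hUt hu).1)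
  filter_upwards [prod_mem_prod hkUV ((hbX.isOpen hU).mem_nhds hxU)] with q hq
  exact hq.1 hq.2

end CompactOpen

theorem isQCB_of_secondCountable {X : Type u} [TopologicalSpace X] [SecondCountableTopology X] :
    IsQCB X :=
  ⟨X, inferInstance, inferInstance, id, IsQuotientMap.id⟩

/-! ### The fan -/

open Classical in
theorem Fan.dist_infty (p : Fan) : dist p .infty = p.radius := by
  change (if p = .infty then 0 else max p.radius (Fan.radius .infty)) = p.radius
  split_ifs with h
  · simp [h, Fan.radius]
  · exact max_eq_left p.radius_nonneg

theorem Fan.nhds_infty_hasBasis :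
    (𝓝 Fan.infty).HasBasis (fun _ : ℕ => True) fun A => {p | ∀ a b, p = .pt a b → A ≤ a} := by
  have key := Metric.nhds_basis_ball_pow (x := Fan.infty) (r := (2⁻¹ : ℝ)) (by norm_num)
    (by norm_num)
  refine key.to_hasBasis (fun n _ => ⟨n + 1, trivial, fun p hp => ?_⟩)
    fun n _ => ⟨n, trivial, fun p hp a b hab => ?_⟩
  · rw [Metric.mem_ball, Fan.dist_infty]
    cases p with
    | pt a b =>
      exact pow_lt_pow_right_of_lt_one₀ (by norm_num) (by norm_num) (hp a b rfl)
    | infty => simp [Fan.radius]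
  · rw [Metric.mem_ball, Fan.dist_infty, hab] at hp
    exact ((pow_lt_pow_iff_right_of_lt_one₀ (by norm_num) (by norm_num)).1 hp).le

theorem Fan.nhds_pt (a b : ℕ) : 𝓝 (Fan.pt a b) = pure (.pt a b) := by
  refine le_antisymm (le_pure_iff.2 ?_) (pure_le_nhds _)
  refine Metric.mem_nhds_iff.2 ⟨(2⁻¹ : ℝ) ^ a, by positivity, fun p hp => ?_⟩
  by_contra hne
  have hd : dist p (Fan.pt a b) = max p.radius (Fan.radius (.pt a b)) := if_neg hne
  rw [Metric.mem_ball, hd] at hp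
  exact absurd ((le_max_right _ _).trans_lt hp) (lt_irrefl _)

instance Fan.instCountable : Countable Fan := by
  refine Function.Injective.countable (β := Option (ℕ × ℕ))
    (f := fun p => match p with | .pt a b => some (a, b) | .infty => none) fun p q => ?_
  cases p <;> cases q <;> simp

instance Fan.instSecondCountableTopology : SecondCountableTopology Fan :=
  UniformSpace.secondCountable_of_separable Fan

/-! ### Finite sections of `∏ M_i` -/

instance FinM.instDiscreteTopology (i : ℕ) : DiscreteTopology (FinM i) := ⟨rfl⟩

theorem finite_dyadicSet (i : ℕ) : (dyadicSet i).Finite := by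
  refine ((Set.finite_Iic (2 ^ i)).image fun j : ℕ => (j : ℝ) / 2 ^ i).subset ?_
  rintro _ ⟨j, hj, rfl⟩
  exact ⟨j, hj, rfl⟩

theorem zero_mem_dyadicSet (i : ℕ) : (0 : ℝ) ∈ dyadicSet i := ⟨0, Nat.zero_le _, by simp⟩

theorem nonneg_of_mem_dyadicSet {i : ℕ} {t : ℝ} (h : t ∈ dyadicSet i) : 0 ≤ t := by
  obtain ⟨j, -, rfl⟩ := h
  positivity

theorem eventually_apply_eq (x : ProdM) (i : ℕ) : ∀ᶠ x' in 𝓝 x, x' i = x i :=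
  (continuous_apply i).continuousAt.eventually ((isOpen_discrete {x i}).mem_nhds rfl)

theorem eventually_f_eq (x : ProdM) (k a b : ℕ) : ∀ᶠ x' in 𝓝 x, f x' k a b = f x k a b := by
  have h : ∀ᶠ x' in 𝓝 x, ∀ i ∈ Finset.Icc a (a + b), x' i = x i :=
    (eventually_all_finset _).2 fun i _ => eventually_apply_eq x i
  filter_upwards [h] with x' hx'
  rw [f, f, Finset.sum_congr rfl fun i hi => congrArg Subtype.val (hx' i hi)]

theorem f_eq_false_iff {x : ProdM} {k a b : ℕ} :
    f x k a b = false ↔ ∑ i ∈ Finset.Icc a (a + b), (x i).val ≤ (2⁻¹ : ℝ) ^ k := by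
  simp [f]

/-! ### The space `M` as a subspace of `ℓ₁` -/

theorem continuous_ell1_apply (i : ℕ) : Continuous fun x : Ell1 => x i :=
  (lp.evalCLM ℝ (fun _ : ℕ => ℝ) 1 i).continuous

theorem isClosed_setM : IsClosed setM := by
  have : setM = ⋂ i, (fun x : Ell1 => x i) ⁻¹' dyadicSet i := by
    ext x; simp [setM]
  rw [this]
  exact isClosed_iInter fun i => (finite_dyadicSet i).isClosed.preimage (continuous_ell1_apply i)

/-- The unit vectors span a dense subspace of `ℓ₁`. -/
instance Ell1.instSeparableSpace : TopologicalSpace.SeparableSpace Ell1 := by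
  rw [← TopologicalSpace.isSeparable_univ_iff]
  have hsep : TopologicalSpace.IsSeparable
      (Submodule.span ℝ (Set.range fun i : ℕ => (lp.single 1 i (1 : ℝ) : Ell1)) : Set Ell1) :=
    (Set.countable_range _).isSeparable.span
  refine hsep.closure.mono fun x _ => ?_
  refine mem_closure_of_tendsto (lp.hasSum_single ENNReal.one_ne_top x)
    (Eventually.of_forall fun s => ?_)
  refine Submodule.sum_mem _ fun i _ => ?_
  have : (lp.single 1 i (x i) : Ell1) = x i • lp.single 1 i (1 : ℝ) := by
    rw [← lp.single_smul, smul_eq_mul, mul_one]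
  rw [this]
  exact Submodule.smul_mem _ _ (Submodule.subset_span ⟨i, rfl⟩)

instance Ell1.instSecondCountableTopology : SecondCountableTopology Ell1 :=
  UniformSpace.secondCountable_of_separable Ell1

theorem polishSpace_spaceM : PolishSpace SpaceM :=
  isClosed_setM.polishSpace

theorem SpaceM.continuous_toProd : Continuous SpaceM.toProd := by
  refine continuous_pi fun i => ?_
  have : Finite (dyadicSet i) := finite_dyadicSet i
  have h : Continuous fun x : SpaceM => (⟨(x : Ell1) i, x.2 i⟩ : dyadicSet i) :=
    ((continuous_ell1_apply i).comp continuous_subtype_val).subtype_mk _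
  let φ : dyadicSet i → FinM i := fun t => ⟨t.1, t.2⟩
  have hφ : Continuous φ := continuous_of_discreteTopology
  exact hφ.comp h

theorem sum_abs_le_norm (z : Ell1) (s : Finset ℕ) : ∑ i ∈ s, |z i| ≤ ‖z‖ := by
  simpa using lp.sum_rpow_le_norm_rpow (p := 1) (by simp) z s

theorem norm_le_of_sum_Icc_le {z : Ell1} {A : ℕ} {c : ℝ} (h0 : ∀ i < A, z i = 0)
    (h : ∀ b, ∑ i ∈ Finset.Icc A (A + b), |z i| ≤ c) : ‖z‖ ≤ c := by
  have hc : 0 ≤ c := (Finset.sum_nonneg fun _ _ => abs_nonneg _).trans (h 0)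
  refine lp.norm_le_of_forall_sum_le (by simp) hc fun s => ?_
  obtain ⟨b, hb⟩ := s.bddAbove
  calc ∑ i ∈ s, ‖z i‖ ^ (1 : ENNReal).toReal = ∑ i ∈ s, |z i| := by simp
    _ ≤ ∑ i ∈ Finset.range A ∪ Finset.Icc A (A + b), |z i| := by
      refine Finset.sum_le_sum_of_subset_of_nonneg (fun i hi => ?_) fun _ _ _ => abs_nonneg _
      have := hb hi
      simp only [Finset.mem_union, Finset.mem_range, Finset.mem_Icc]
      omega
    _ ≤ ∑ i ∈ Finset.range A, |z i| + ∑ i ∈ Finset.Icc A (A + b), |z i| := by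
      rw [← Finset.sum_union_inter]
      exact le_add_of_nonneg_right (Finset.sum_nonneg fun _ _ => abs_nonneg _)
    _ ≤ c := by
      rw [Finset.sum_eq_zero fun i hi => by rw [h0 i (Finset.mem_range.1 hi), abs_zero], zero_add]
      exact h b
    _ = c ^ (1 : ENNReal).toReal := by simp

/-- Near a point of `M`, the tails are uniformly small. -/
theorem SpaceM.exists_eventually_sum_le (x : SpaceM) (k : ℕ) :
    ∃ A, ∀ᶠ y : SpaceM in 𝓝 x, ∀ a ≥ A, ∀ b,
      ∑ i ∈ Finset.Icc a (a + b), (y : Ell1) i ≤ (2⁻¹ : ℝ) ^ k := by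
  have hε : (0 : ℝ) < 2⁻¹ ^ k / 2 := by positivity
  have hsum : Summable fun i => (x : Ell1) i := by
    refine Summable.of_norm ?_
    simpa using (lp.memℓp (x : Ell1)).summable (by simp)
  obtain ⟨s, hs⟩ := summable_iff_vanishing_norm.1 hsum _ hε
  obtain ⟨B, hB⟩ := s.bddAbove
  refine ⟨B + 1, ?_⟩
  filter_upwards [Metric.ball_mem_nhds x hε] with y hy a ha b
  have h1 : ∑ i ∈ Finset.Icc a (a + b), (x : Ell1) i ≤ 2⁻¹ ^ k / 2 := by
    refine (le_abs_self _).trans (hs _ (Finset.disjoint_left.2 fun i hi his => ?_)).le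
    have := hB his
    have := (Finset.mem_Icc.1 hi).1
    omega
  have h2 : ‖(y : Ell1) - x‖ < 2⁻¹ ^ k / 2 := by
    rwa [Metric.mem_ball, Subtype.dist_eq, dist_eq_norm] at hy
  have h3 := sum_abs_le_norm ((y : Ell1) - x) (Finset.Icc a (a + b))
  have h4 : ∑ i ∈ Finset.Icc a (a + b), (y : Ell1) i ≤
      ∑ i ∈ Finset.Icc a (a + b), ((x : Ell1) i + |((y : Ell1) - x) i|) :=
    Finset.sum_le_sum fun i _ => by
      have := le_abs_self (((y : Ell1) - x) i)
      rw [lp.coeFn_sub, Pi.sub_apply] at this ⊢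
      linarith
  rw [Finset.sum_add_distrib] at h4
  linarith

/-- A sequence in `M` converges if it converges coordinatewise and its tails are uniformly
small. -/
theorem SpaceM.tendsto_of_sum_le {y : ℕ → SpaceM} {x : SpaceM}
    (hc : ∀ i, ∀ᶠ n in atTop, (y n : Ell1) i = (x : Ell1) i)
    (ht : ∀ k : ℕ, ∃ A, ∀ᶠ n in atTop, ∀ a ≥ A, ∀ b,
      ∑ i ∈ Finset.Icc a (a + b), (y n : Ell1) i ≤ (2⁻¹ : ℝ) ^ k) :
    Tendsto y atTop (𝓝 x) := by
  rw [Metric.tendsto_nhds]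
  intro ε hε
  obtain ⟨k, hk⟩ := exists_pow_lt_of_lt_one (half_pos hε) (show (2⁻¹ : ℝ) < 1 by norm_num)
  obtain ⟨A, hA⟩ := ht k
  obtain ⟨A', hA'⟩ := x.exists_eventually_sum_le k
  have hcoord : ∀ᶠ n in atTop, ∀ i ∈ Finset.range (max A A'), (y n : Ell1) i = (x : Ell1) i :=
    (eventually_all_finset _).2 fun i _ => hc i
  filter_upwards [hA, hcoord] with n hn hcn
  rw [Subtype.dist_eq, dist_eq_norm]
  refine (norm_le_of_sum_Icc_le (A := max A A') (c := 2⁻¹ ^ k + 2⁻¹ ^ k) (fun i hi => ?_)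
    fun b => ?_).trans_lt (by linarith)
  · rw [lp.coeFn_sub, Pi.sub_apply, hcn i (Finset.mem_range.2 hi), sub_self]
  · refine le_trans ?_ (add_le_add (hn _ (le_max_left A A') b)
      (hA'.self_of_nhds _ (le_max_right A A') b))
    rw [← Finset.sum_add_distrib]
    refine Finset.sum_le_sum fun i _ => ?_
    rw [lp.coeFn_sub, Pi.sub_apply]
    have h1 := nonneg_of_mem_dyadicSet ((y n).2 i)
    have h2 := nonneg_of_mem_dyadicSet (x.2 i)
    exact abs_le.2 ⟨by linarith, by linarith⟩

/-! ### The section -/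

theorem continuous_uncurry_g : Continuous fun q : SpaceM × (ℕ × Fan) => g q.1 q.2 := by
  rw [continuous_iff_continuousAt]
  rintro ⟨x, k, p⟩
  rw [ContinuousAt, nhds_discrete Bool, tendsto_pure, nhds_prod_eq, nhds_prod_eq, nhds_discrete ℕ]
  cases p with
  | pt a b =>
    rw [Fan.nhds_pt, pure_prod, map_pure, prod_pure, eventually_map]
    exact SpaceM.continuous_toProd.continuousAt.eventually (eventually_f_eq _ k a b)
  | infty =>
    obtain ⟨A, hA⟩ := x.exists_eventually_sum_le k
    filter_upwards [prod_mem_prod hA (prod_mem_prod (mem_pure.2 (Set.mem_singleton k))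
      (Fan.nhds_infty_hasBasis.mem_of_mem (i := A) trivial))]
    rintro ⟨y, k', q⟩ ⟨hy, hk, hq⟩
    obtain rfl : k' = k := hk
    cases q with
    | pt a b => exact f_eq_false_iff.2 (hy a (hq a b rfl) b)
    | infty => rfl

/-- The section `x ↦ (x, g x)`. -/
noncomputable def sectionMap : C(SpaceM, QProd ProdM TwoPow) where
  toFun x := .of (x.toProd, .of ((⟨_, continuous_uncurry_g⟩ : C(SpaceM × (ℕ × Fan), Bool)).curry x))
  continuous_toFun := Seqn.continuous_of_val <| SpaceM.continuous_toProd.prodMk <|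
    Seqn.continuous_of_val (ContinuousMap.curry _).continuous

theorem isSectionMap_sectionMap : IsSectionMap sectionMap := fun _ => ⟨rfl, rfl⟩

/-! ### The retraction -/

theorem eventually_fst_apply_eq (p : QProd ProdM TwoPow) (i : ℕ) :
    ∀ᶠ q in 𝓝 p, q.val.1 i = p.val.1 i :=
  (continuous_fst.comp Seqn.continuous_val).continuousAt.eventually (eventually_apply_eq p.val.1 i)

theorem eventually_snd_apply_eq (p : QProd ProdM TwoPow) (y : ℕ × Fan) :
    ∀ᶠ q in 𝓝 p, q.val.2.val y = p.val.2.val y := by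
  have h : Continuous fun q : QProd ProdM TwoPow => q.val.2.val y :=
    (continuous_eval_const y).comp <|
      Seqn.continuous_val.comp <| continuous_snd.comp Seqn.continuous_val
  exact h.continuousAt.eventually ((isOpen_discrete {p.val.2.val y}).mem_nhds rfl)

theorem eventually_mem_C_iff (m : ℕ) (p : QProd ProdM TwoPow) :
    ∀ᶠ q in 𝓝 p, (q ∈ C m ↔ p ∈ C m) := by
  have h : ∀ᶠ q in 𝓝 p, ∀ k ∈ Set.Iic m, ∀ a ∈ Set.Iic m, ∀ b ∈ Set.Iic m,
      q.val.2.val (k, .infty) = p.val.2.val (k, .infty) ∧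
      q.val.2.val (k, .pt a b) = p.val.2.val (k, .pt a b) ∧
      f q.val.1 k a b = f p.val.1 k a b := by
    refine (eventually_all_finite (Set.finite_Iic m)).2 fun k _ =>
      (eventually_all_finite (Set.finite_Iic m)).2 fun a _ =>
      (eventually_all_finite (Set.finite_Iic m)).2 fun b _ => ?_
    have hf : ∀ᶠ q in 𝓝 p, f q.val.1 k a b = f p.val.1 k a b :=
      (continuous_fst.comp Seqn.continuous_val).continuousAt.eventually
        (eventually_f_eq p.val.1 k a b)
    exact (eventually_snd_apply_eq p _).and ((eventually_snd_apply_eq p _).and hf)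
  filter_upwards [h] with q hq
  refine forall₂_congr fun k hk => forall₂_congr fun a ha => forall₂_congr fun b hb => ?_
  obtain ⟨h1, h2, h3⟩ := hq k hk a ha b hb
  rw [h1, h2, h3]

theorem isClopen_C (m : ℕ) : IsClopen (C m) := by
  rw [IsClopen, ← isOpen_compl_iff]
  constructor <;> refine isOpen_iff_mem_nhds.2 fun p hp => ?_
  · filter_upwards [eventually_mem_C_iff m p] with q hq using mt hq.1 hp
  · filter_upwards [eventually_mem_C_iff m p] with q hq using hq.2 hp

theorem antitone_C : Antitone C := fun _ _ h _ hp k hk a ha b hb =>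
  hp k (hk.trans h) a (ha.trans h) b (hb.trans h)

theorem rSeq_mem_dyadicSet (p : QProd ProdM TwoPow) (m : ℕ) : rSeq p m ∈ dyadicSet m := by
  unfold rSeq
  split_ifs
  · exact (p.val.1 m).2
  · exact zero_mem_dyadicSet m

open Classical in
theorem eventually_rSeq_eq (p : QProd ProdM TwoPow) (m : ℕ) :
    ∀ᶠ q in 𝓝 p, rSeq q m = rSeq p m := by
  filter_upwards [eventually_mem_C_iff m p, eventually_fst_apply_eq p m] with q h1 h2
  rw [rSeq, rSeq, h2]
  exact if_congr h1 rfl rfl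

/-- Of the terms of `rSeq p` from `a` to `a + b`, those that can be nonzero form an initial
segment, and the sum over the longest one is controlled by `h`. -/
theorem sum_rSeq_le {p : QProd ProdM TwoPow} {k A : ℕ} (hk : k ≤ A)
    (h : ∀ a ≥ A, ∀ b, p.val.2.val (k, .pt a b) = false) {a : ℕ} (ha : A ≤ a) (b : ℕ) :
    ∑ i ∈ Finset.Icc a (a + b), rSeq p i ≤ (2⁻¹ : ℝ) ^ k := by
  induction b with
  | zero =>
    by_cases hp : p ∈ C a
    · have := (hp k (hk.trans ha) a le_rfl 0 (Nat.zero_le _)).2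
      rw [h a ha 0, eq_comm, f_eq_false_iff] at this
      simpa [rSeq, hp] using this
    · simp [rSeq, hp]
  | succ b ih =>
    by_cases hp : p ∈ C (a + (b + 1))
    · have := (hp k (by omega) a (by omega) (b + 1) (by omega)).2
      rw [h a ha (b + 1), eq_comm, f_eq_false_iff] at this
      refine le_of_eq_of_le (Finset.sum_congr rfl fun i hi => ?_) this
      exact if_pos (antitone_C (Finset.mem_Icc.1 hi).2 hp)
    · rw [← add_assoc, Finset.sum_Icc_succ_top (by omega)]
      rwa [show rSeq p (a + b + 1) = 0 from if_neg hp, add_zero]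

/-- Along a convergent sequence, the tails of `rSeq` are uniformly small. -/
theorem exists_eventually_sum_rSeq_le {q : ℕ → QProd ProdM TwoPow} {p : QProd ProdM TwoPow}
    (hq : Tendsto q atTop (𝓝 p)) (k : ℕ) :
    ∃ A, ∀ᶠ n in atTop, ∀ a ≥ A, ∀ b,
      ∑ i ∈ Finset.Icc a (a + b), rSeq (q n) i ≤ (2⁻¹ : ℝ) ^ k := by
  rcases Bool.eq_false_or_eq_true (p.val.2.val (k, .infty)) with htrue | hfalse
  · -- then almost all terms lie outside `C k`, so that `rSeq` vanishes from `k` on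
    refine ⟨k, ?_⟩
    filter_upwards [hq.eventually (eventually_snd_apply_eq p (k, .infty))] with n hn a ha b
    rw [Finset.sum_eq_zero fun i hi => ?_]
    · positivity
    refine if_neg fun hC => ?_
    have hki : k ≤ i := ha.trans (Finset.mem_Icc.1 hi).1
    have := (hC k hki 0 (Nat.zero_le _) 0 (Nat.zero_le _)).1
    rw [hn, htrue] at this
    exact Bool.noConfusion this
  · have h2 : Tendsto (fun n => (q n).val.2.val) atTop (𝓝 p.val.2.val) :=
      Seqn.tendsto_iff.1 ((Prod.tendsto_iff _ _).1 (Seqn.tendsto_iff.1 hq)).2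
    have h3 := tendsto_compactOpen_iff_tendsto_prod.1 h2 (k, .infty)
    rw [hfalse, nhds_discrete Bool, tendsto_pure, nhds_prod_eq, nhds_discrete ℕ] at h3
    obtain ⟨s, hs, t, ht, hst⟩ := mem_prod_iff.1 h3
    rw [pure_prod, mem_map, Fan.nhds_infty_hasBasis.mem_iff] at ht
    obtain ⟨A, -, hA⟩ := ht
    refine ⟨max A k, ?_⟩
    filter_upwards [hs] with n hn a ha b
    refine sum_rSeq_le (le_max_right A k) (fun a' ha' b' => ?_) ha b
    refine hst (Set.mk_mem_prod hn (hA fun a'' b'' h => ?_))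
    obtain ⟨rfl, rfl⟩ := Fan.pt.inj h
    exact (le_max_left A k).trans ha'

theorem memℓp_rSeq (p : QProd ProdM TwoPow) : Memℓp (rSeq p) 1 := by
  obtain ⟨A, hA⟩ := exists_eventually_sum_rSeq_le (tendsto_const_nhds (x := p)) 0
  obtain ⟨_, hA⟩ := hA.exists
  refine memℓp_gen ?_
  have hnn (i : ℕ) : 0 ≤ rSeq p i := nonneg_of_mem_dyadicSet (rSeq_mem_dyadicSet p i)
  simp only [ENNReal.toReal_one, Real.rpow_one, Real.norm_of_nonneg (hnn _)]
  rw [← summable_nat_add_iff A]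
  refine summable_of_sum_range_le (c := 1) (fun i => hnn _) fun n => ?_
  refine le_trans ?_ ((hA A le_rfl n).trans_eq (pow_zero _))
  calc ∑ i ∈ Finset.range n, rSeq p (i + A) = ∑ i ∈ Finset.Ico A (A + n), rSeq p i := by
        rw [Finset.sum_Ico_eq_sum_range, Nat.add_sub_cancel_left]
        exact Finset.sum_congr rfl fun i _ => by rw [add_comm]
    _ ≤ ∑ i ∈ Finset.Icc A (A + n), rSeq p i :=
        Finset.sum_le_sum_of_subset_of_nonneg Finset.Ico_subset_Icc_self fun i _ _ => hnn i

/-- The retraction `r_M`. -/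
noncomputable def retractionMap : C(QProd ProdM TwoPow, SpaceM) where
  toFun p := ⟨⟨rSeq p, memℓp_rSeq p⟩, rSeq_mem_dyadicSet p⟩
  continuous_toFun := SeqContinuous.continuous fun _ p hq => SpaceM.tendsto_of_sum_le
    (fun i => hq.eventually (eventually_rSeq_eq p i)) (exists_eventually_sum_rSeq_le hq)

theorem isRetractionMap_retractionMap : IsRetractionMap retractionMap := fun _ _ => rfl

theorem retractionMap_sectionMap (x : SpaceM) : retractionMap (sectionMap x) = x := by
  refine Subtype.ext (lp.ext (funext fun m => ?_))
  exact if_pos fun k _ a _ b _ => ⟨rfl, rfl⟩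

/-! ### The QCB-product as a retract of `2 ^ (ℕ × F)` -/

/-- The unary code of an element of `M_i`: the bits `j = 0, …, 2 ^ i` tell whether the element is
`j / 2 ^ i`. -/
noncomputable def FinM.bits {i : ℕ} (t : FinM i) (j : ℕ) : Bool :=
  open Classical in decide (t.val = (j : ℝ) / 2 ^ i)

theorem FinM.bits_injective (i : ℕ) :
    Function.Injective fun (t : FinM i) (j : Fin (2 ^ i + 1)) => t.bits j := by
  rintro t t' h
  obtain ⟨j, hj, ht⟩ := t.2
  have hbit := congrFun h ⟨j, by omega⟩
  simp only [FinM.bits, decide_eq_decide] at hbit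
  exact Subtype.ext (ht.trans (hbit.1 ht).symm)

instance FinM.instNonempty (i : ℕ) : Nonempty (FinM i) := ⟨⟨0, zero_mem_dyadicSet i⟩⟩

/-- The encoding of a pair `(x, h)` as one function on `ℕ × F`: the layers `k + 1` hold `h`, and the
isolated points `(0, (0, c))` hold the bits of `x`. -/
noncomputable def encodeFun (p : QProd ProdM TwoPow) : ℕ × Fan → Bool
  | (0, .pt 0 c) => (p.val.1 c.unpair.1).bits c.unpair.2
  | (0, .pt (_ + 1) _) => false
  | (0, .infty) => false
  | (k + 1, y) => p.val.2.val (k, y)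

theorem tendsto_encodeFun {q : ℕ → QProd ProdM TwoPow} {p : QProd ProdM TwoPow}
    (hq : Tendsto q atTop (𝓝 p)) (z : ℕ × Fan) :
    Tendsto (fun n : ℕ × (ℕ × Fan) => encodeFun (q n.1) n.2) (atTop ×ˢ 𝓝 z)
      (𝓝 (encodeFun p z)) := by
  obtain ⟨k, y⟩ := z
  rw [nhds_prod_eq, nhds_discrete ℕ, pure_prod]
  cases k with
  | zero =>
    rw [nhds_discrete Bool, tendsto_pure]
    cases y with
    | pt a c =>
      rw [Fan.nhds_pt, map_pure, prod_pure, eventually_map]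
      cases a with
      | zero =>
        filter_upwards [hq.eventually (eventually_fst_apply_eq p c.unpair.1)] with n hn
        simp only [encodeFun, hn]
      | succ a => exact Eventually.of_forall fun _ => rfl
    | infty =>
      have hnear : ∀ᶠ z in map (Prod.mk 0) (𝓝 Fan.infty), ∀ x, encodeFun x z = false := by
        rw [eventually_map]
        filter_upwards [Fan.nhds_infty_hasBasis.mem_of_mem (i := 1) trivial] with y hy x
        match y, hy with
        | .pt 0 c, hy => exact absurd (hy 0 c rfl) (by omega)
        | .pt (a + 1) c, _ => rfl
        | .infty, _ => rfl
      exact hnear.prod_inr _ |>.mono fun n hn => hn _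
  | succ k =>
    have h2 : Tendsto (fun n => (q n).val.2.val) atTop (𝓝 p.val.2.val) :=
      Seqn.tendsto_iff.1 ((Prod.tendsto_iff _ _).1 (Seqn.tendsto_iff.1 hq)).2
    have h3 := tendsto_compactOpen_iff_tendsto_prod.1 h2 (k, y)
    rw [nhds_prod_eq, nhds_discrete ℕ, pure_prod, ← map_id (f := atTop), prod_map_map_eq,
      tendsto_map'_iff] at h3
    rw [← map_id (f := atTop), prod_map_map_eq, tendsto_map'_iff]
    exact h3

/-- The encoding as a continuous map. -/
noncomputable def encode : C(QProd ProdM TwoPow, TwoPow) where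
  toFun p := .of
    { toFun := encodeFun p
      continuous_toFun := by
        rw [continuous_iff_continuousAt]
        intro z
        have h := tendsto_encodeFun (tendsto_const_nhds (x := p)) z
        change Tendsto (encodeFun p ∘ Prod.snd) _ _ at h
        rwa [← tendsto_map'_iff, map_snd_prod] at h }
  continuous_toFun := SeqContinuous.continuous fun _ _ hq =>
    Seqn.tendsto_iff.2 (tendsto_compactOpen_of_tendsto_prod (tendsto_encodeFun hq))

/-- The decoding of a function on `ℕ × F`, which inverts `encode` on its range. -/
noncomputable def decode : C(TwoPow, QProd ProdM TwoPow) where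
  toFun H := .of
    (fun i => Function.invFun (fun (t : FinM i) (j : Fin (2 ^ i + 1)) => t.bits j)
        fun j => H.val (0, .pt 0 (Nat.pair i j)),
      .of (H.val.comp ⟨fun z : ℕ × Fan => (z.1 + 1, z.2), by fun_prop⟩))
  continuous_toFun := by
    refine Seqn.continuous_of_val (.prodMk (continuous_pi fun i => ?_)
      (Seqn.continuous_of_val ((ContinuousMap.continuous_precomp _).comp Seqn.continuous_val)))
    have hbits : Continuous fun (H : TwoPow) (j : Fin (2 ^ i + 1)) =>
        H.val (0, .pt 0 (Nat.pair i j)) :=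
      continuous_pi fun _ => (continuous_eval_const _).comp Seqn.continuous_val
    exact (continuous_of_discreteTopology (f := Function.invFun
      fun (t : FinM i) (j : Fin (2 ^ i + 1)) => t.bits j)).comp hbits

theorem decode_encode (p : QProd ProdM TwoPow) : decode (encode p) = p := by
  obtain ⟨x, ⟨h⟩⟩ := p
  refine congrArg Seqn.of (Prod.ext (funext fun i => ?_) rfl)
  refine Eq.trans ?_ (Function.leftInverse_invFun (FinM.bits_injective i) (x i))
  refine congrArg (Function.invFun fun (t : FinM i) (j : Fin (2 ^ i + 1)) => t.bits j)
    (funext fun j => ?_)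
  simp only [encode, ContinuousMap.coe_mk, encodeFun]
  rw [Nat.unpair_pair]

/-! ### `2 ^ (ℕ × F)` as a retract of `ℕ ^ (ℕ ^ ℕ)` -/

/-- The point `(a, b)` of the fan as the sequence with the single nonzero term `b + 1` at `a`, and
the point at infinity as the zero sequence. -/
def Fan.toSeq : Fan → ℕ → ℕ
  | .pt a b, n => if n = a then b + 1 else 0
  | .infty, _ => 0

theorem Fan.continuous_toSeq : Continuous Fan.toSeq := by
  refine continuous_pi fun n => continuous_iff_continuousAt.2 fun p => ?_
  rw [ContinuousAt, nhds_discrete ℕ, tendsto_pure]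
  cases p with
  | pt a b => rw [Fan.nhds_pt]; rfl
  | infty =>
    filter_upwards [Fan.nhds_infty_hasBasis.mem_of_mem (i := n + 1) trivial] with p hp
    cases p with
    | pt a b => exact if_neg (by have := hp a b rfl; omega)
    | infty => rfl

open Classical in
/-- The retraction of the Baire space onto the fan: the point that the first nonzero term of a
sequence determines. -/
noncomputable def Fan.ofSeq (v : ℕ → ℕ) : Fan :=
  if h : ∃ n, v n ≠ 0 then .pt (Nat.find h) (v (Nat.find h) - 1) else .infty

theorem Fan.ofSeq_eq_pt_iff {v : ℕ → ℕ} {a b : ℕ} :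
    Fan.ofSeq v = .pt a b ↔ (∀ i < a, v i = 0) ∧ v a = b + 1 := by
  classical
  unfold Fan.ofSeq
  split_ifs with h
  · rw [Fan.pt.injEq]
    constructor
    · rintro ⟨rfl, rfl⟩
      have := Nat.find_spec h
      exact ⟨fun i hi => not_not.1 (Nat.find_min h hi), by omega⟩
    · rintro ⟨h0, ha⟩
      have hfind : Nat.find h = a :=
        (Nat.find_eq_iff h).2 ⟨by omega, fun i hi => not_not.2 (h0 i hi)⟩
      rw [hfind, ha]
      exact ⟨rfl, rfl⟩
  · push Not at h
    exact ⟨fun h' => (nomatch h'), fun h' => by have := h a; omega⟩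

theorem Fan.ofSeq_eq_infty_iff {v : ℕ → ℕ} : Fan.ofSeq v = .infty ↔ ∀ n, v n = 0 := by
  unfold Fan.ofSeq
  split_ifs with h
  · exact ⟨fun h' => (nomatch h'), fun h' => absurd h' (not_forall.2 h)⟩
  · push Not at h
    exact ⟨fun _ => h, fun _ => rfl⟩

theorem Fan.ofSeq_toSeq (p : Fan) : Fan.ofSeq p.toSeq = p := by
  cases p with
  | pt a b => exact Fan.ofSeq_eq_pt_iff.2 ⟨fun i hi => if_neg hi.ne, if_pos rfl⟩
  | infty => exact Fan.ofSeq_eq_infty_iff.2 fun _ => rfl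

theorem Fan.continuous_ofSeq : Continuous Fan.ofSeq := by
  refine continuous_iff_continuousAt.2 fun v => ?_
  have hev (N : ℕ) : ∀ᶠ w in 𝓝 v, ∀ i ∈ Finset.range N, w i = v i :=
    (eventually_all_finset _).2 fun i _ =>
      (continuous_apply i).continuousAt.eventually ((isOpen_discrete {v i}).mem_nhds rfl)
  rw [ContinuousAt]
  cases h : Fan.ofSeq v with
  | pt a b =>
    rw [Fan.nhds_pt, tendsto_pure]
    rw [Fan.ofSeq_eq_pt_iff] at h
    filter_upwards [hev (a + 1)] with w hw
    simp only [Finset.mem_range] at hw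
    exact Fan.ofSeq_eq_pt_iff.2
      ⟨fun i hi => (hw i (by omega)).trans (h.1 i hi), (hw a (by omega)).trans h.2⟩
  | infty =>
    rw [Fan.ofSeq_eq_infty_iff] at h
    refine Fan.nhds_infty_hasBasis.tendsto_right_iff.2 fun A _ => ?_
    filter_upwards [hev A] with w hw a b hab
    by_contra hlt
    have h1 := (Fan.ofSeq_eq_pt_iff.1 hab).2
    have h2 := hw a (Finset.mem_range.2 (by omega))
    have h3 := h a
    omega

/-- The embedding of `ℕ × F` into the Baire space. -/
noncomputable def toBaire : C(ℕ × Fan, ℕ → ℕ) where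
  toFun z := fun n => Nat.casesOn n z.1 z.2.toSeq
  continuous_toFun := continuous_pi fun n => match n with
    | 0 => continuous_fst
    | n + 1 => (continuous_apply n).comp (Fan.continuous_toSeq.comp continuous_snd)

/-- The retraction of the Baire space onto `ℕ × F`. -/
noncomputable def ofBaire : C(ℕ → ℕ, ℕ × Fan) where
  toFun w := (w 0, Fan.ofSeq fun n => w (n + 1))
  continuous_toFun := (continuous_apply 0).prodMk <|
    Fan.continuous_ofSeq.comp (continuous_pi fun n => continuous_apply (n + 1))

theorem ofBaire_toBaire (z : ℕ × Fan) : ofBaire (toBaire z) = z :=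
  Prod.ext rfl (Fan.ofSeq_toSeq z.2)

/-- The embedding of `2 ^ (ℕ × F)` into `ℕ ^ (ℕ ^ ℕ)`. -/
noncomputable def twoPowToNNN : C(TwoPow, NNN) :=
  Seqn.map ⟨fun h => (⟨Bool.toNat, continuous_of_discreteTopology⟩ : C(Bool, ℕ)).comp
      (h.comp ofBaire),
    (ContinuousMap.continuous_postcomp _).comp (ContinuousMap.continuous_precomp ofBaire)⟩

/-- The retraction of `ℕ ^ (ℕ ^ ℕ)` onto `2 ^ (ℕ × F)`. -/
noncomputable def nnnToTwoPow : C(NNN, TwoPow) :=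
  Seqn.map ⟨fun H => (⟨fun n => n != 0, continuous_of_discreteTopology⟩ : C(ℕ, Bool)).comp
      (H.comp toBaire),
    (ContinuousMap.continuous_postcomp _).comp (ContinuousMap.continuous_precomp toBaire)⟩

theorem nnnToTwoPow_twoPowToNNN (h : TwoPow) : nnnToTwoPow (twoPowToNNN h) = h := by
  refine congrArg Seqn.of (ContinuousMap.ext fun z => ?_)
  change ((h.val (ofBaire (toBaire z))).toNat != 0) = h.val z
  rw [ofBaire_toBaire]
  cases h.val z <;> rfl

/-! ### The retracts in QCB -/

theorem isQCB_twoPow : IsQCB TwoPow := hasSeqNetwork_continuousMap.isQCB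

theorem isQCB_nnn : IsQCB NNN := hasSeqNetwork_continuousMap.isQCB

theorem isQCB_prodM_twoPow : IsQCB (QProd ProdM TwoPow) := by
  have (i : ℕ) : Countable (FinM i) := (finite_dyadicSet i).countable.to_subtype
  exact (hasSeqNetwork_of_secondCountable.prod hasSeqNetwork_continuousMap.seqn).isQCB

theorem isQCB_spaceM : IsQCB SpaceM := isQCB_of_secondCountable

theorem isQCBRetract_twoPow : IsQCBRetract SpaceM TwoPow :=
  ⟨isQCB_spaceM, isQCB_twoPow, encode.comp sectionMap, retractionMap.comp decode, fun x => by
    simp only [ContinuousMap.comp_apply, decode_encode, retractionMap_sectionMap]⟩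

theorem IsQCBRetract.trans_nnn {X : Type} [TopologicalSpace X] (h : IsQCBRetract X TwoPow) :
    IsQCBRetract X NNN := by
  obtain ⟨hX, -, e, r, hre⟩ := h
  refine ⟨hX, isQCB_nnn, twoPowToNNN.comp e, r.comp nnnToTwoPow, fun x => ?_⟩
  simp only [ContinuousMap.comp_apply, nnnToTwoPow_twoPowToNNN, hre]

end WMRetract

theorem proposition3p7 :
    -- `M` is closed in `ℓ₁` and a Polish space
    (IsClosed WMRetract.setM ∧ PolishSpace WMRetract.SpaceM) ∧
    -- `x ↦ (x, g x)` and `r_M` are well defined, continuous, and a section-retraction pair in QCB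
    (WMRetract.IsQCB WMRetract.SpaceM ∧
      WMRetract.IsQCB (WMRetract.QProd WMRetract.ProdM WMRetract.TwoPow) ∧
      (∀ m, IsClopen (WMRetract.C m)) ∧
      ∃ (e : C(WMRetract.SpaceM, WMRetract.QProd WMRetract.ProdM WMRetract.TwoPow))
        (r : C(WMRetract.QProd WMRetract.ProdM WMRetract.TwoPow, WMRetract.SpaceM)),
        WMRetract.IsSectionMap e ∧ WMRetract.IsRetractionMap r ∧ ∀ x, r (e x) = x) ∧
    -- `M` is a retract of the QCB-exponentials `2 ^ (ℕ × F)` and `ℕ ^ (ℕ ^ ℕ)`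
    WMRetract.IsQCBRetract WMRetract.SpaceM WMRetract.TwoPow ∧
    WMRetract.IsQCBRetract WMRetract.SpaceM WMRetract.NNN := by
  refine ⟨⟨WMRetract.isClosed_setM, WMRetract.polishSpace_spaceM⟩,
    ⟨WMRetract.isQCB_spaceM, WMRetract.isQCB_prodM_twoPow, WMRetract.isClopen_C,
      WMRetract.sectionMap, WMRetract.retractionMap, WMRetract.isSectionMap_sectionMap,
      WMRetract.isRetractionMap_retractionMap, WMRetract.retractionMap_sectionMap⟩,
    WMRetract.isQCBRetract_twoPow, WMRetract.isQCBRetract_twoPow.trans_nnn⟩
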